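/- \textbf{Theorem A.} All Banach spaces are real. For a Banach space $Y$ with unit sphere $S_Y$, $y\in S_Y$ and $t>0$, put \[ \tilde\delta_Y(y,t)=\sup_{E}\ \inf_{z\in E,\ \|z\|=1}\max\{\|y+tz\|,\|y-tz\|\}-1, \] where the supremum is over all closed subspaces $E$ of $Y$ of finite codimension and the infimum over the empty set is $+\infty$. The space $Y$ is \emph{locally asymptotically midpoint uniformly convex} (locally AMUC) if $\tilde\delta_Y(y,t)>0$ for all $y\in S_Y$ and $t>0$. A \emph{basic} sequence is a sequence that is a Schauder basis of its closed linear span; two basic sequences $(x_n)$, $(y_n)$ are \emph{equivalent} if $x_n\mapsto y_n$ extends to an isomorphism between their closed linear spans; a basic sequence $(x_n)$ is \emph{symmetric} if for every permutation $\sigma$ of $\mathbb N$ the sequence $(x_{\sigma(n)})$ is a basis of the closed linear span of $(x_n)$ that is equivalent to $(x_n)$. A sequence $(x_n)$ is \emph{normalized} if $\|x_n\|=1$ for every $n$. For $1<p<\infty$, a normalized sequence $(x_n)$ has \emph{upper $p$-estimates} if there is $C>0$ with \[ \Big\|\sum_{k=1}^n a_kx_k\Big\|\le C\Big(\sum_{k=1}^n|a_k|^p\Big)^{1/p}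 \] for all $n\in\mathbb N$ and all real $a_1,\dots,a_n$. A bounded operator $T:X\to Y$ is \emph{norm-attaining} if $\|Tx\|=\|T\|$ for some $x$ in the closed unit ball of $X$, and $Y$ has \emph{property B} if for every Banach space $X$ the norm-attaining operators are norm-dense in the space $\mathscr L(X,Y)$ of bounded linear operators. Let $Y$ be a locally AMUC Banach space. Suppose that $Y$ contains either a normalized symmetric basic sequence that is not equivalent to the unit vector basis of $\ell_1$, or, for some $1<p<\infty$, a normalized sequence with upper $p$-estimates. Then $Y$ fails property B. -/

import Mathlib

/-- The closed linear span of a sequence. -/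
abbrev closedSpan {Y : Type*} [NormedAddCommGroup Y] [NormedSpace ℝ Y] (x : ℕ → Y) :
    Submodule ℝ Y :=
  (Submodule.span ℝ (Set.range x)).topologicalClosure

/-- `T` belongs to `NA(X, Y)`: it attains its norm at a point of the closed unit ball. -/
def NormAttaining {X Y : Type*} [NormedAddCommGroup X] [NormedSpace ℝ X]
    [NormedAddCommGroup Y] [NormedSpace ℝ Y] (T : X →L[ℝ] Y) : Prop :=
  ∃ x ∈ Metric.closedBall (0 : X) 1, ‖T x‖ = ‖T‖

/-- Lindenstrauss' property B: for every real Banach space `X`, the norm-attaining operators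
from `X` to `Y` are dense, in the operator norm, in the space of all bounded operators. -/
def PropertyB.{v, u} (Y : Type u) [NormedAddCommGroup Y] [NormedSpace ℝ Y] : Prop :=
  ∀ (X : Type v) [NormedAddCommGroup X] [NormedSpace ℝ X] [CompleteSpace X],
    Dense {T : X →L[ℝ] Y | NormAttaining T}

/-- `cof(Y)`: the closed subspaces of `Y` of finite codimension. -/
def cof (Y : Type*) [NormedAddCommGroup Y] [NormedSpace ℝ Y] : Set (Submodule ℝ Y) :=
  {E | IsClosed (E : Set Y) ∧ FiniteDimensional ℝ (Y ⧸ E)}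

/-- The modulus `δ̃_Y(y, t)`. It takes values in the extended reals, so that the infimum over
an empty sphere (which occurs for `E = 0` only) is `+∞`. -/
noncomputable def amucModulus {Y : Type*} [NormedAddCommGroup Y] [NormedSpace ℝ Y]
    (y : Y) (t : ℝ) : EReal :=
  (⨆ E ∈ cof Y, ⨅ z ∈ {z : Y | z ∈ E ∧ ‖z‖ = 1},
    ((max ‖y + t • z‖ ‖y - t • z‖ : ℝ) : EReal)) - 1

/-- Locally asymptotically midpoint uniformly convex spaces. -/
def LocallyAMUC (Y : Type*) [NormedAddCommGroup Y] [NormedSpace ℝ Y] : Prop :=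
  ∀ y : Y, ‖y‖ = 1 → ∀ t : ℝ, 0 < t → 0 < amucModulus y t

/-- All terms have norm one. -/
def NormalizedSeq {Y : Type*} [NormedAddCommGroup Y] (x : ℕ → Y) : Prop :=
  ∀ n, ‖x n‖ = 1

/-- A basic sequence: a Schauder basis of its closed linear span. -/
def IsBasicSeq {Y : Type*} [NormedAddCommGroup Y] [NormedSpace ℝ Y] (x : ℕ → Y) : Prop :=
  ∃ b : SchauderBasis ℝ (closedSpan x), ∀ n, (b n : Y) = x n

/-- Equivalence of basic sequences: `x n ↦ y n` extends to an isomorphism between the closed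
linear spans, that is, the norms of finite linear combinations are comparable. -/
def SeqEquivalent {X Y : Type*} [NormedAddCommGroup X] [NormedSpace ℝ X]
    [NormedAddCommGroup Y] [NormedSpace ℝ Y] (x : ℕ → X) (y : ℕ → Y) : Prop :=
  ∃ c > (0 : ℝ), ∃ C > (0 : ℝ), ∀ (n : ℕ) (a : ℕ → ℝ),
    c * ‖∑ k ∈ Finset.range n, a k • x k‖ ≤ ‖∑ k ∈ Finset.range n, a k • y k‖ ∧
      ‖∑ k ∈ Finset.range n, a k • y k‖ ≤ C * ‖∑ k ∈ Finset.range n, a k • x k‖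

/-- A symmetric basic sequence: each of its permutations is a basis of the closed linear span
(which does not depend on the permutation) and is equivalent to the sequence itself. -/
def IsSymmetricBasicSeq {Y : Type*} [NormedAddCommGroup Y] [NormedSpace ℝ Y]
    (x : ℕ → Y) : Prop :=
  IsBasicSeq x ∧ ∀ σ : Equiv.Perm ℕ, IsBasicSeq (x ∘ σ) ∧ SeqEquivalent (x ∘ σ) x

/-- The unit vector basis of `ℓ₁`. -/
noncomputable def l1UnitVector (n : ℕ) : lp (fun _ : ℕ => ℝ) 1 :=
  lp.single 1 n (1 : ℝ)

/-- Upper `p`-estimates. -/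
def HasUpperEstimates {Y : Type*} [NormedAddCommGroup Y] [NormedSpace ℝ Y]
    (p : ℝ) (x : ℕ → Y) : Prop :=
  ∃ C > (0 : ℝ), ∀ (n : ℕ) (a : ℕ → ℝ),
    ‖∑ k ∈ Finset.range n, a k • x k‖ ≤ C * (∑ k ∈ Finset.range n, |a k| ^ p) ^ (1 / p)

universe v u

open Filter Topology

theorem tendsto_zero_of_forall_dual {V : Type*} [NormedAddCommGroup V] [NormedSpace ℝ V]
    [FiniteDimensional ℝ V] {v : ℕ → V}
    (h : ∀ f : V →L[ℝ] ℝ, Tendsto (fun n => f (v n)) atTop (𝓝 0)) : Tendsto v atTop (𝓝 0) := by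
  let b := Module.finBasis ℝ V
  let φ := b.equivFun.toContinuousLinearEquiv
  have hφ : Tendsto (fun n => φ (v n)) atTop (𝓝 0) := by
    refine tendsto_pi_nhds.2 fun i => ?_
    exact h ((ContinuousLinearMap.proj i).comp (φ : V →L[ℝ] (Fin _ → ℝ)))
  have := (φ.symm.continuous.tendsto 0).comp hφ
  simpa [Function.comp_def] using this

theorem norm_add_smul_le_max {Y : Type*} [NormedAddCommGroup Y] [NormedSpace ℝ Y] (y u : Y)
    {s t : ℝ} (hs : 0 ≤ s) (hst : s ≤ t) :
    max ‖y + s • u‖ ‖y - s • u‖ ≤ max ‖y + t • u‖ ‖y - t • u‖ := by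
  have key : ∀ v : Y, ‖y + s • v‖ ≤ max ‖y + t • v‖ ‖y - t • v‖ := by
    intro v
    rcases (hs.trans hst).eq_or_lt with rfl | ht
    · obtain rfl : s = 0 := le_antisymm hst hs
      simp
    · have hr : s / t ≤ 1 := (div_le_one ht).2 hst
      have hr0 : 0 ≤ s / t := by positivity
      have hst' : s / t * t = s := by field_simp
      generalize s / t = r at *
      have : y + s • v = ((1 + r) / 2) • (y + t • v) + ((1 - r) / 2) • (y - t • v) := by
        rw [← hst']; module
      calc ‖y + s • v‖ ≤ ‖((1 + r) / 2) • (y + t • v)‖ + ‖((1 - r) / 2) • (y - t • v)‖ := by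
            rw [this]; exact norm_add_le _ _
        _ = (1 + r) / 2 * ‖y + t • v‖ + (1 - r) / 2 * ‖y - t • v‖ := by
            rw [norm_smul, norm_smul, Real.norm_of_nonneg (by linarith),
              Real.norm_of_nonneg (by linarith)]
        _ ≤ _ := by
            have h1 := le_max_left ‖y + t • v‖ ‖y - t • v‖
            have h2 := le_max_right ‖y + t • v‖ ‖y - t • v‖
            nlinarith
  refine max_le (key u) ?_
  have := key (-u)
  simpa [sub_eq_add_neg, max_comm] using this

theorem LocallyAMUC.exists_gap {Y : Type*} [NormedAddCommGroup Y] [NormedSpace ℝ Y]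
    (hY : LocallyAMUC Y) {y : Y} (hy : ‖y‖ = 1) {t : ℝ} (ht : 0 < t) :
    ∃ E ∈ cof Y, ∃ η > (0 : ℝ), ∀ z ∈ E, ‖z‖ = 1 → 1 + η ≤ max ‖y + t • z‖ ‖y - t • z‖ := by
  have h := hY y hy t ht
  rw [amucModulus, EReal.sub_pos] at h
  obtain ⟨E, hE⟩ := lt_iSup_iff.1 h
  obtain ⟨hEc, hE⟩ := lt_iSup_iff.1 hE
  obtain ⟨c, hc1, hc2⟩ := EReal.lt_iff_exists_real_btwn.1 hE
  have hc1 : 1 < c := by exact_mod_cast hc1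
  refine ⟨E, hEc, c - 1, by linarith, fun z hz hz1 => ?_⟩
  have := hc2.le.trans (iInf₂_le z ⟨hz, hz1⟩)
  rw [add_sub_cancel]
  exact_mod_cast this

/-- A norm-attaining operator into a locally AMUC space cannot be bounded below on a weakly null
sequence along which every point of the unit ball can be perturbed in both directions. -/
theorem NormAttaining.exists_norm_lt {X Y : Type*} [NormedAddCommGroup X] [NormedSpace ℝ X]
    [NormedAddCommGroup Y] [NormedSpace ℝ Y] (hY : LocallyAMUC Y) {S : X →L[ℝ] Y}
    (hS : NormAttaining S) {e : ℕ → X}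
    (hweak : ∀ f : X →L[ℝ] ℝ, Tendsto (fun n => f (e n)) atTop (𝓝 0))
    (hflat : ∀ x : X, ‖x‖ ≤ 1 →
      ∃ δ > (0 : ℝ), ∀ᶠ n in atTop, ‖x + δ • e n‖ ≤ 1 ∧ ‖x - δ • e n‖ ≤ 1)
    {r : ℝ} (hr : 0 < r) : ∃ n, ‖S (e n)‖ < r := by
  by_contra! hbig
  obtain ⟨x, hx, hSx⟩ := hS
  have hx1 : ‖x‖ ≤ 1 := by simpa using hx
  have hSpos : 0 < ‖S‖ := by
    refine (norm_nonneg S).lt_of_ne fun h0 => ?_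
    have := hbig 0
    have := S.le_opNorm (e 0)
    rw [← h0] at this
    linarith
  obtain ⟨δ, hδ, hfl⟩ := hflat x hx1
  set s := ‖S‖ with hs
  set y : Y := s⁻¹ • S x with hy
  have hy1 : ‖y‖ = 1 := by
    rw [hy, norm_smul, hSx, Real.norm_of_nonneg (by positivity)]; field_simp
  set τ := δ / s with hτ
  have hτpos : 0 < τ := by positivity
  have hle : ∀ᶠ n in atTop, max ‖y + τ • S (e n)‖ ‖y - τ • S (e n)‖ ≤ 1 := by
    filter_upwards [hfl] with n hn
    have e1 : y + τ • S (e n) = s⁻¹ • S (x + δ • e n) := by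
      rw [map_add, map_smul, smul_add, smul_smul, hτ, div_eq_inv_mul]
    have e2 : y - τ • S (e n) = s⁻¹ • S (x - δ • e n) := by
      rw [map_sub, map_smul, smul_sub, smul_smul, hτ, div_eq_inv_mul]
    have key : ∀ z : X, ‖z‖ ≤ 1 → ‖s⁻¹ • S z‖ ≤ 1 := by
      intro z hz
      rw [norm_smul, Real.norm_of_nonneg (by positivity), inv_mul_le_iff₀ hSpos, mul_one]
      exact S.unit_le_opNorm z hz
    rw [e1, e2]
    exact max_le (key _ hn.1) (key _ hn.2)
  obtain ⟨E, ⟨hEclosed, hEfin⟩, η, hη, hgap⟩ :=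
    hY.exists_gap hy1 (t := τ * (r / 2)) (by positivity)
  have : IsClosed (E : Set Y) := hEclosed
  have := hEfin
  have hq : Tendsto (fun n => E.mkQL (S (e n))) atTop (𝓝 0) :=
    tendsto_zero_of_forall_dual fun f => hweak (f.comp (E.mkQL.comp S))
  set κ := min (r / 2) (η / (2 * τ)) with hκ
  have hκpos : 0 < κ := by positivity
  have hq' : ∀ᶠ n in atTop, ‖E.mkQL (S (e n))‖ < κ := by
    have := hq.norm
    rw [norm_zero] at this
    exact this.eventually (gt_mem_nhds hκpos)
  obtain ⟨n, hn1, hn2⟩ := (hle.and hq').exists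
  obtain ⟨m, hm, hmn⟩ := Submodule.Quotient.norm_mk_lt (E.mkQL (S (e n)))
    (ε := κ - ‖E.mkQL (S (e n))‖) (by linarith)
  have hmκ : ‖m‖ < κ := by linarith
  set z := S (e n) - m with hz
  have hzE : z ∈ E := by
    rw [← Submodule.Quotient.mk_eq_zero, hz, Submodule.Quotient.mk_sub, hm]
    simp
  have hznorm : r / 2 ≤ ‖z‖ := by
    have h1 := norm_sub_norm_le (S (e n)) m
    have h2 := hbig n
    have h3 : κ ≤ r / 2 := min_le_left _ _
    linarith
  have hzpos : 0 < ‖z‖ := by linarith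
  have hg := hgap (‖z‖⁻¹ • z) (E.smul_mem _ hzE) (by rw [norm_smul]; simp [hzpos.ne'])
  have hmono := norm_add_smul_le_max y (‖z‖⁻¹ • z) (s := τ * (r / 2)) (t := τ * ‖z‖)
    (by positivity) (by gcongr)
  have hzz : (τ * ‖z‖) • ‖z‖⁻¹ • z = τ • z := by
    rw [smul_smul, mul_assoc, mul_inv_cancel₀ hzpos.ne', mul_one]
  rw [hzz] at hmono
  have hτm : ‖τ • m‖ ≤ η / 2 := by
    rw [norm_smul, Real.norm_of_nonneg hτpos.le]
    have : κ ≤ η / (2 * τ) := min_le_right _ _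
    calc τ * ‖m‖ ≤ τ * (η / (2 * τ)) := by gcongr; linarith
      _ = η / 2 := by field_simp
  have hmax : max ‖y + τ • z‖ ‖y - τ • z‖ ≤ 1 + η / 2 := by
    obtain ⟨h1, h2⟩ := max_le_iff.1 hn1
    refine max_le ?_ ?_
    · have : y + τ • z = (y + τ • S (e n)) - τ • m := by rw [hz]; module
      rw [this]
      exact (norm_sub_le _ _).trans (by linarith)
    · have : y - τ • z = (y - τ • S (e n)) + τ • m := by rw [hz]; module
      rw [this]
      exact (norm_add_le _ _).trans (by linarith)
  linarith

open scoped ENNReal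

section LorentzPredual

variable {w : ℕ → ℝ}

theorem sum_range_weight_pos (hw : ∀ k, 0 < w k) {m : ℕ} (hm : 0 < m) :
    0 < ∑ k ∈ Finset.range m, w k :=
  Finset.sum_pos (fun k _ => hw k) ⟨0, by simpa using hm⟩

theorem sum_range_weight_mono (hw : ∀ k, 0 < w k) {j k : ℕ} (hjk : j ≤ k) :
    ∑ l ∈ Finset.range j, w l ≤ ∑ l ∈ Finset.range k, w l :=
  Finset.sum_le_sum_of_subset_of_nonneg (by simpa using hjk) fun l _ _ => (hw l).le

theorem mul_sum_range_weight_le (hanti : Antitone w) {j k : ℕ} (hjk : j ≤ k) :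
    (j : ℝ) * ∑ l ∈ Finset.range k, w l ≤ k * ∑ l ∈ Finset.range j, w l := by
  induction k, hjk using Nat.le_induction with
  | base => exact le_rfl
  | succ k hjk ih =>
    have h : (j : ℝ) * w k ≤ ∑ l ∈ Finset.range j, w l := by
      have := Finset.card_nsmul_le_sum (Finset.range j) w (w k)
        fun l hl => hanti ((Finset.mem_range.1 hl).le.trans hjk)
      simpa using this
    rw [Finset.sum_range_succ]
    push_cast
    linarith

/-- The indices of the functionals which norm the predual of a Lorentz sequence space: a finite
set together with a choice of signs. -/
abbrev LorentzIndex : Type v := ULift.{v} (Finset ℕ × (ℕ → ℤˣ))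

theorem abs_signed_sum_le (A : Finset ℕ) (ε : ℕ → ℤˣ) (a : ℕ → ℝ) :
    |∑ k ∈ A, ((ε k : ℤ) : ℝ) * a k| ≤ ∑ k ∈ A, |a k| := by
  refine (Finset.abs_sum_le_sum_abs _ _).trans (Finset.sum_le_sum fun k _ => ?_)
  rcases Int.units_eq_one_or (ε k) with h | h <;> simp [h]

theorem exists_units_mul_eq_abs (r : ℝ) : ∃ ε : ℤˣ, ((ε : ℤ) : ℝ) * r = |r| := by
  rcases le_total 0 r with h | h
  · exact ⟨1, by simp [abs_of_nonneg h]⟩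
  · exact ⟨-1, by simp [abs_of_nonpos h]⟩

theorem sum_abs_finsupp_le (A : Finset ℕ) (a : ℕ →₀ ℝ) :
    ∑ k ∈ A, |a k| ≤ ∑ k ∈ a.support, |a k| := by
  calc ∑ k ∈ A, |a k| ≤ ∑ k ∈ A ∪ a.support, |a k| :=
        Finset.sum_le_sum_of_subset_of_nonneg Finset.subset_union_left fun k _ _ => abs_nonneg _
    _ = ∑ k ∈ a.support, |a k| := by
        refine (Finset.sum_subset Finset.subset_union_right fun k _ hk => ?_).symm
        simpa using hk

/-- Finitely supported sequences, embedded isometrically for the norm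
`sup (|a k₁| + ⋯ + |a kₙ|) / (w 0 + ⋯ + w (n - 1))`. -/
noncomputable def lorentzEmbed (hw : ∀ k, 0 < w k) :
    (ℕ →₀ ℝ) →ₗ[ℝ] lp (fun _ : LorentzIndex.{v} => ℝ) ∞ where
  toFun a := ⟨fun i => (∑ k ∈ i.down.1, ((i.down.2 k : ℤ) : ℝ) * a k) /
      ∑ k ∈ Finset.range i.down.1.card, w k, by
    refine memℓp_infty ⟨(∑ k ∈ a.support, |a k|) / w 0, ?_⟩
    rintro _ ⟨⟨A, ε⟩, rfl⟩
    have h0 : 0 ≤ ∑ k ∈ a.support, |a k| := Finset.sum_nonneg fun _ _ => abs_nonneg _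
    rcases A.eq_empty_or_nonempty with rfl | hA
    · simpa using div_nonneg h0 (hw 0).le
    · change |(∑ k ∈ A, ((ε k : ℤ) : ℝ) * a k) / ∑ k ∈ Finset.range A.card, w k| ≤ _
      have h1 : w 0 ≤ ∑ k ∈ Finset.range A.card, w k := by
        simpa using sum_range_weight_mono hw (j := 1) hA.card_pos
      rw [abs_div, abs_of_pos ((hw 0).trans_le h1)]
      exact div_le_div₀ h0 ((abs_signed_sum_le _ _ _).trans (sum_abs_finsupp_le _ _)) (hw 0) h1⟩
  map_add' a b := by
    ext i
    simp only [Finsupp.coe_add, Pi.add_apply, mul_add, Finset.sum_add_distrib, add_div,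
      lp.coeFn_add]
  map_smul' c a := by
    ext i
    simp only [Finsupp.coe_smul, Pi.smul_apply, smul_eq_mul, RingHom.id_apply, lp.coeFn_smul]
    rw [← mul_div_assoc, Finset.mul_sum]
    congr 1
    exact Finset.sum_congr rfl fun k _ => by ring

theorem lorentzEmbed_apply (hw : ∀ k, 0 < w k) (a : ℕ →₀ ℝ) (A : Finset ℕ) (ε : ℕ → ℤˣ) :
    lorentzEmbed.{v} hw a ⟨(A, ε)⟩ =
      (∑ k ∈ A, ((ε k : ℤ) : ℝ) * a k) / ∑ k ∈ Finset.range A.card, w k := rfl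

theorem weight_mul_lorentzEmbed_apply (hw : ∀ k, 0 < w k) (a : ℕ →₀ ℝ) (A : Finset ℕ)
    (ε : ℕ → ℤˣ) :
    (∑ k ∈ Finset.range A.card, w k) * lorentzEmbed.{v} hw a ⟨(A, ε)⟩ =
      ∑ k ∈ A, ((ε k : ℤ) : ℝ) * a k := by
  rcases A.eq_empty_or_nonempty with rfl | hA
  · simp
  · rw [lorentzEmbed_apply, mul_div_cancel₀ _ (sum_range_weight_pos hw hA.card_pos).ne']

/-- The predual of the Lorentz sequence space `d(w, 1)`. -/
noncomputable abbrev LorentzPredual (hw : ∀ k, 0 < w k) :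
    Submodule ℝ (lp (fun _ : LorentzIndex.{v} => ℝ) ∞) :=
  (LinearMap.range (lorentzEmbed.{v} hw)).topologicalClosure

/-- Finitely supported sequences as elements of the Lorentz predual. -/
noncomputable def lorentzIncl (hw : ∀ k, 0 < w k) : (ℕ →₀ ℝ) →ₗ[ℝ] LorentzPredual.{v} hw :=
  (lorentzEmbed.{v} hw).codRestrict _ fun a =>
    Submodule.le_topologicalClosure _ (LinearMap.mem_range_self _ a)

theorem coe_lorentzIncl (hw : ∀ k, 0 < w k) (a : ℕ →₀ ℝ) :
    (lorentzIncl.{v} hw a : lp (fun _ : LorentzIndex.{v} => ℝ) ∞) = lorentzEmbed hw a := rfl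

theorem norm_lorentzIncl (hw : ∀ k, 0 < w k) (a : ℕ →₀ ℝ) :
    ‖lorentzIncl.{v} hw a‖ = ‖lorentzEmbed.{v} hw a‖ := rfl

theorem LorentzPredual.exists_norm_sub_lt (hw : ∀ k, 0 < w k) (x : LorentzPredual.{v} hw) {r : ℝ}
    (hr : 0 < r) :
    ∃ a : ℕ →₀ ℝ, ‖(x : lp (fun _ : LorentzIndex.{v} => ℝ) ∞) - lorentzEmbed hw a‖ < r := by
  obtain ⟨_, ⟨a, rfl⟩, ha⟩ := Metric.mem_closure_iff.1 x.2 r hr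
  exact ⟨a, by rwa [← dist_eq_norm]⟩

theorem denseRange_lorentzIncl (hw : ∀ k, 0 < w k) : DenseRange (lorentzIncl.{v} hw) := by
  refine Metric.denseRange_iff.2 fun x r hr => ?_
  obtain ⟨a, ha⟩ := LorentzPredual.exists_norm_sub_lt hw x hr
  exact ⟨a, by rw [dist_eq_norm]; exact ha⟩

theorem LorentzPredual.abs_apply_le (hw : ∀ k, 0 < w k) (x : LorentzPredual.{v} hw)
    (i : LorentzIndex.{v}) : |x.1 i| ≤ ‖x‖ :=
  lp.norm_apply_le_norm ENNReal.top_ne_zero x.1 i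

theorem LorentzPredual.weight_mul_apply (hw : ∀ k, 0 < w k) (x : LorentzPredual.{v} hw)
    {A : Finset ℕ} {n : ℕ} (hn : n ∈ A) (ε : ℕ → ℤˣ) :
    (∑ k ∈ Finset.range A.card, w k) * x.1 ⟨(A, ε)⟩ =
      (∑ k ∈ Finset.range (A.card - 1), w k) * x.1 ⟨(A.erase n, ε)⟩ +
        ((ε n : ℤ) : ℝ) * (w 0 * x.1 ⟨({n}, 1)⟩) := by
  have hev : ∀ i : LorentzIndex.{v},
      Continuous fun y : LorentzPredual.{v} hw => y.1 i := fun i =>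
    (lp.lipschitzWith_one_eval (E := fun _ : LorentzIndex.{v} => ℝ) ∞ i).continuous.comp
      continuous_subtype_val
  refine (denseRange_lorentzIncl hw).induction_on (p := fun y : LorentzPredual.{v} hw =>
    (∑ k ∈ Finset.range A.card, w k) * y.1 ⟨(A, ε)⟩ =
      (∑ k ∈ Finset.range (A.card - 1), w k) * y.1 ⟨(A.erase n, ε)⟩ +
        ((ε n : ℤ) : ℝ) * (w 0 * y.1 ⟨({n}, 1)⟩)) x ?_ fun a => ?_
  · exact isClosed_eq (continuous_const.mul (hev _)) ((continuous_const.mul (hev _)).add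
      (continuous_const.mul (continuous_const.mul (hev _))))
  · simp only [coe_lorentzIncl]
    rw [weight_mul_lorentzEmbed_apply, ← Finset.card_erase_of_mem hn,
      weight_mul_lorentzEmbed_apply]
    have h1 := weight_mul_lorentzEmbed_apply.{v} hw a {n} 1
    simp only [Finset.card_singleton, Finset.sum_range_one, Finset.sum_singleton, Pi.one_apply,
      Units.val_one, Int.cast_one, one_mul] at h1
    rw [h1, Finset.sum_erase_add _ _ hn]

theorem LorentzPredual.tendsto_coord (hw : ∀ k, 0 < w k) (x : LorentzPredual.{v} hw) :
    Tendsto (fun n => x.1 ⟨({n}, 1)⟩) atTop (𝓝 0) := by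
  rw [Metric.tendsto_atTop]
  intro r hr
  obtain ⟨a, ha⟩ := LorentzPredual.exists_norm_sub_lt hw x hr
  refine ⟨a.support.sup id + 1, fun n hn => ?_⟩
  have han : a n = 0 := by
    by_contra h
    have := Finset.le_sup (f := id) (Finsupp.mem_support_iff.2 h)
    simp only [id] at this
    omega
  have h := (lp.norm_apply_le_norm ENNReal.top_ne_zero
    (x.1 - lorentzEmbed hw a) ⟨({n}, 1)⟩).trans_lt ha
  rw [lp.coeFn_sub, Pi.sub_apply, lorentzEmbed_apply] at h
  simpa [han] using h

theorem LorentzPredual.exists_abs_le_of_card (hw : ∀ k, 0 < w k)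
    (hinf : Tendsto (fun n => ∑ k ∈ Finset.range n, w k) atTop atTop)
    (x : LorentzPredual.{v} hw) {r : ℝ} (hr : 0 < r) :
    ∃ N : ℕ, ∀ (A : Finset ℕ) (ε : ℕ → ℤˣ), N ≤ A.card → |x.1 ⟨(A, ε)⟩| ≤ r := by
  obtain ⟨a, ha⟩ := LorentzPredual.exists_norm_sub_lt hw x (half_pos hr)
  obtain ⟨N, hN⟩ := (hinf.eventually_ge_atTop
    ((∑ k ∈ a.support, |a k|) / (r / 2))).exists_forall_of_atTop
  refine ⟨N + 1, fun A ε hA => ?_⟩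
  have h := (lp.norm_apply_le_norm ENNReal.top_ne_zero
    (x.1 - lorentzEmbed hw a) ⟨(A, ε)⟩).trans_lt ha
  rw [lp.coeFn_sub, Pi.sub_apply, Real.norm_eq_abs] at h
  have hW : 0 < ∑ k ∈ Finset.range A.card, w k := sum_range_weight_pos hw (by omega)
  have h2 : |lorentzEmbed.{v} hw a ⟨(A, ε)⟩| ≤ r / 2 := by
    rw [lorentzEmbed_apply, abs_div, abs_of_pos hW, div_le_iff₀ hW]
    refine ((abs_signed_sum_le _ _ _).trans (sum_abs_finsupp_le _ _)).trans ?_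
    have := hN A.card (by omega)
    rwa [div_le_iff₀ (half_pos hr), mul_comm] at this
  have := abs_sub_abs_le_abs_sub (x.1 ⟨(A, ε)⟩) (lorentzEmbed.{v} hw a ⟨(A, ε)⟩)
  linarith

theorem LorentzPredual.exists_flat (hw : ∀ k, 0 < w k) (hanti : Antitone w)
    (hinf : Tendsto (fun n => ∑ k ∈ Finset.range n, w k) atTop atTop)
    (x : LorentzPredual.{v} hw) (hx : ‖x‖ ≤ 1) :
    ∃ δ > (0 : ℝ), ∀ᶠ n in atTop, ‖x + δ • lorentzIncl hw (Finsupp.single n 1)‖ ≤ 1 ∧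
      ‖x - δ • lorentzIncl hw (Finsupp.single n 1)‖ ≤ 1 := by
  obtain ⟨N, hN⟩ := LorentzPredual.exists_abs_le_of_card hw hinf x (r := 1 / 2) (by norm_num)
  have hδ : 0 < w N / 2 := half_pos (hw N)
  have hco : ∀ᶠ n in atTop, |w 0 * x.1 ⟨({n}, 1)⟩| < w N / 2 := by
    have := ((LorentzPredual.tendsto_coord hw x).const_mul (w 0)).abs
    rw [mul_zero, abs_zero] at this
    exact this.eventually (gt_mem_nhds hδ)
  refine ⟨w N / 2, hδ, ?_⟩
  filter_upwards [hco] with n hn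
  have hbound : ∀ i : LorentzIndex.{v},
      |x.1 i| + w N / 2 * |lorentzEmbed.{v} hw (Finsupp.single n 1) i| ≤ 1 := by
    rintro ⟨A, ε⟩
    by_cases hnA : n ∈ A
    · have hcard : 0 < A.card := Finset.card_pos.2 ⟨n, hnA⟩
      have hW : 0 < ∑ k ∈ Finset.range A.card, w k := sum_range_weight_pos hw hcard
      have hsum : |∑ k ∈ A, ((ε k : ℤ) : ℝ) * (Finsupp.single n (1 : ℝ)) k| ≤ 1 := by
        refine (abs_signed_sum_le _ _ _).trans ((sum_abs_finsupp_le _ _).trans ?_)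
        simp [Finsupp.support_single]
      have he : |lorentzEmbed.{v} hw (Finsupp.single n 1) ⟨(A, ε)⟩| ≤
          1 / ∑ k ∈ Finset.range A.card, w k := by
        rw [lorentzEmbed_apply, abs_div, abs_of_pos hW]
        gcongr
      rcases le_or_gt N A.card with hNA | hNA
      · have h1 := hN A ε hNA
        have h2 : w N ≤ ∑ k ∈ Finset.range A.card, w k := by
          refine (hanti (Nat.zero_le N)).trans ?_
          simpa using sum_range_weight_mono hw (j := 1) hcard
        have h3 : w N / 2 * |lorentzEmbed.{v} hw (Finsupp.single n 1) ⟨(A, ε)⟩| ≤ 1 / 2 := by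
          refine (mul_le_mul_of_nonneg_left he hδ.le).trans ?_
          rw [mul_one_div, div_le_iff₀ hW]
          linarith
        linarith
      · have h1 : (∑ k ∈ Finset.range A.card, w k) * |x.1 ⟨(A, ε)⟩| ≤
            (∑ k ∈ Finset.range (A.card - 1), w k) + w N / 2 := by
          have h0 : (∑ k ∈ Finset.range A.card, w k) * |x.1 ⟨(A, ε)⟩| =
              |(∑ k ∈ Finset.range A.card, w k) * x.1 ⟨(A, ε)⟩| := by
            rw [abs_mul, abs_of_pos hW]
          rw [h0, LorentzPredual.weight_mul_apply hw x hnA]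
          refine (abs_add_le _ _).trans (add_le_add ?_ ?_)
          · rw [abs_mul, abs_of_nonneg (Finset.sum_nonneg fun k _ => (hw k).le)]
            exact mul_le_of_le_one_right (Finset.sum_nonneg fun k _ => (hw k).le)
              ((LorentzPredual.abs_apply_le hw x _).trans hx)
          · rw [abs_mul]
            have : |((ε n : ℤ) : ℝ)| = 1 := by
              rcases Int.units_eq_one_or (ε n) with h | h <;> simp [h]
            rw [this, one_mul]
            exact hn.le
        have h2 : (∑ k ∈ Finset.range A.card, w k) *
            |lorentzEmbed.{v} hw (Finsupp.single n 1) ⟨(A, ε)⟩| ≤ 1 := by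
          rwa [le_div_iff₀ hW, mul_comm] at he
        have h3 : ∑ k ∈ Finset.range A.card, w k =
            (∑ k ∈ Finset.range (A.card - 1), w k) + w (A.card - 1) := by
          rw [← Finset.sum_range_succ, Nat.sub_add_cancel hcard]
        have h4 : w N ≤ w (A.card - 1) := hanti (by omega)
        refine le_of_mul_le_mul_left ?_ hW
        have h5 := mul_le_mul_of_nonneg_left h2 hδ.le
        linarith
    · have : lorentzEmbed.{v} hw (Finsupp.single n 1) ⟨(A, ε)⟩ = 0 := by
        rw [lorentzEmbed_apply, Finset.sum_eq_zero, zero_div]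
        intro k hk
        rw [Finsupp.single_eq_of_ne (by rintro rfl; exact hnA hk), mul_zero]
      rw [this, abs_zero, mul_zero, add_zero]
      exact (LorentzPredual.abs_apply_le hw x _).trans hx
  constructor
  · refine lp.norm_le_of_forall_le (f := x.1 + (w N / 2) • lorentzEmbed hw (Finsupp.single n 1))
      zero_le_one fun i => ?_
    rw [lp.coeFn_add, Pi.add_apply, lp.coeFn_smul, Pi.smul_apply, smul_eq_mul]
    refine (norm_add_le _ _).trans ?_
    rw [norm_mul, Real.norm_of_nonneg hδ.le]
    exact hbound i
  · refine lp.norm_le_of_forall_le (f := x.1 - (w N / 2) • lorentzEmbed hw (Finsupp.single n 1))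
      zero_le_one fun i => ?_
    rw [lp.coeFn_sub, Pi.sub_apply, lp.coeFn_smul, Pi.smul_apply, smul_eq_mul]
    refine (norm_sub_le _ _).trans ?_
    rw [norm_mul, Real.norm_of_nonneg hδ.le]
    exact hbound i

theorem norm_lorentzIncl_le_of_abs_le (hw : ∀ k, 0 < w k) (hanti : Antitone w) (a : ℕ →₀ ℝ)
    {s : Finset ℕ} (hs : s.Nonempty) (ha : ∀ k ∈ s, |a k| ≤ 1) (ha' : ∀ k ∉ s, a k = 0) :
    ‖lorentzIncl.{v} hw a‖ ≤ s.card / ∑ k ∈ Finset.range s.card, w k := by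
  have hWs := sum_range_weight_pos hw hs.card_pos
  rw [norm_lorentzIncl]
  refine lp.norm_le_of_forall_le (by positivity) ?_
  rintro ⟨A, ε⟩
  have h1 : |∑ k ∈ A, ((ε k : ℤ) : ℝ) * a k| ≤ (A ∩ s).card := by
    refine (abs_signed_sum_le A ε a).trans ?_
    rw [← Finset.sum_subset (s₁ := A ∩ s) Finset.inter_subset_left]
    · refine (Finset.sum_le_card_nsmul _ _ 1 fun k hk => ha k (Finset.mem_inter.1 hk).2).trans ?_
      simp
    · intro k hkA hk
      rw [ha' k fun hks => hk (Finset.mem_inter.2 ⟨hkA, hks⟩), abs_zero]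
  rcases (A ∩ s).eq_empty_or_nonempty with h0 | hne
  · rw [h0, Finset.card_empty, Nat.cast_zero] at h1
    rw [lorentzEmbed_apply, abs_nonpos_iff.1 h1, zero_div, norm_zero]
    positivity
  · have hWj := sum_range_weight_pos hw hne.card_pos
    have hWA := sum_range_weight_mono hw (Finset.card_le_card (Finset.inter_subset_left (s₁ := A)
      (s₂ := s)))
    rw [lorentzEmbed_apply, Real.norm_eq_abs, abs_div, abs_of_pos (hWj.trans_le hWA)]
    calc |∑ k ∈ A, ((ε k : ℤ) : ℝ) * a k| / ∑ k ∈ Finset.range A.card, w k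
        ≤ (A ∩ s).card / ∑ k ∈ Finset.range (A ∩ s).card, w k := by gcongr
      _ ≤ s.card / ∑ k ∈ Finset.range s.card, w k := by
        rw [div_le_div_iff₀ hWj hWs]
        exact mul_sum_range_weight_le hanti (Finset.card_le_card Finset.inter_subset_right)

theorem tendsto_dual_lorentzIncl_single (hw : ∀ k, 0 < w k) (hanti : Antitone w)
    (hinf : Tendsto (fun n => ∑ k ∈ Finset.range n, w k) atTop atTop)
    (f : LorentzPredual.{v} hw →L[ℝ] ℝ) :
    Tendsto (fun n => f (lorentzIncl hw (Finsupp.single n 1))) atTop (𝓝 0) := by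
  rw [Metric.tendsto_atTop]
  by_contra! hcon
  obtain ⟨c, hc, hfr⟩ := hcon
  simp only [dist_zero_right] at hfr
  have hset : {n | c ≤ ‖f (lorentzIncl hw (Finsupp.single n 1))‖}.Infinite := by
    refine Set.infinite_of_not_bddAbove ?_
    rintro ⟨N, hN⟩
    obtain ⟨n, hn, hcn⟩ := hfr (N + 1)
    have := hN hcn
    omega
  obtain ⟨k, hk1, hk⟩ := ((eventually_ge_atTop 1).and
    (hinf.eventually_gt_atTop (‖f‖ / c))).exists
  obtain ⟨s, hs, hsk⟩ := hset.exists_subset_card_eq k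
  choose ε hε using fun n => exists_units_mul_eq_abs (f (lorentzIncl hw (Finsupp.single n 1)))
  set a : ℕ →₀ ℝ := ∑ n ∈ s, Finsupp.single n ((ε n : ℤ) : ℝ) with ha
  have haval : ∀ j, a j = if j ∈ s then ((ε j : ℤ) : ℝ) else 0 := by
    intro j
    simp [ha, Finsupp.finsetSum_apply, Finsupp.single_apply]
  have hfa : f (lorentzIncl hw a) = ∑ n ∈ s, |f (lorentzIncl hw (Finsupp.single n 1))| := by
    rw [ha, map_sum, map_sum]
    refine Finset.sum_congr rfl fun n _ => ?_
    rw [← hε n, ← smul_eq_mul, ← map_smul, ← map_smul, Finsupp.smul_single, smul_eq_mul, mul_one]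
  have hlow : k * c ≤ f (lorentzIncl hw a) := by
    rw [hfa, ← hsk, ← nsmul_eq_mul]
    exact Finset.card_nsmul_le_sum _ _ _ fun n hn => hs hn
  have hup : ‖lorentzIncl.{v} hw a‖ ≤ k / ∑ l ∈ Finset.range k, w l := by
    rw [← hsk]
    refine norm_lorentzIncl_le_of_abs_le hw hanti a (Finset.card_pos.1 (by omega)) ?_ ?_
    · intro j hj
      rw [haval, if_pos hj]
      rcases Int.units_eq_one_or (ε j) with h | h <;> simp [h]
    · intro j hj
      rw [haval, if_neg hj]
  have hW := sum_range_weight_pos hw (m := k) (by omega)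
  have h1 : k * c ≤ ‖f‖ * (k / ∑ l ∈ Finset.range k, w l) :=
    hlow.trans ((le_abs_self _).trans ((f.le_opNorm _).trans (by gcongr)))
  have hkpos : (0 : ℝ) < k := by exact_mod_cast hk1
  rw [div_lt_iff₀ hc] at hk
  rw [← mul_div_assoc, le_div_iff₀ hW] at h1
  nlinarith

end LorentzPredual

theorem exists_enum_sum_mul_le {w : ℕ → ℝ} {R : ℝ} (a : ℕ → ℝ) (m : ℕ) :
    ∀ s : Finset ℕ, s.card = m →
      (∀ A ⊆ s, ∑ k ∈ A, a k ≤ R * ∑ k ∈ Finset.range A.card, w k) →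
      ∀ b : ℕ → ℝ, (∀ k ∈ s, 0 ≤ b k) →
        ∃ i : ℕ → ℕ, Set.InjOn i (Finset.range m) ∧ (∀ k < m, i k ∈ s) ∧
          ∑ k ∈ s, a k * b k ≤ R * ∑ k ∈ Finset.range m, w k * b (i k) := by
  induction m with
  | zero =>
    intro s hs _ b _
    obtain rfl := Finset.card_eq_zero.1 hs
    exact ⟨id, by simp, by simp, by simp⟩
  | succ m ih =>
    intro s hs hA b hb
    obtain ⟨k₀, hk₀, hmin⟩ := s.exists_min_image b (Finset.card_pos.1 (by omega))
    obtain ⟨i, hi, his, hsum⟩ := ih (s.erase k₀) (by rw [Finset.card_erase_of_mem hk₀]; omega)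
      (fun A h => hA A (h.trans (Finset.erase_subset _ _))) (fun k => b k - b k₀)
      (fun k hk => sub_nonneg.2 (hmin k (Finset.mem_of_mem_erase hk)))
    have hupd : ∀ k < m, Function.update i m k₀ k = i k := fun k hk =>
      Function.update_of_ne hk.ne _ _
    refine ⟨Function.update i m k₀, ?_, ?_, ?_⟩
    · intro k hk l hl hkl
      simp only [Finset.coe_range, Set.mem_Iio] at hk hl
      rcases Nat.lt_succ_iff_lt_or_eq.1 hk with hk' | rfl <;>
        rcases Nat.lt_succ_iff_lt_or_eq.1 hl with hl' | rfl
      · rw [hupd k hk', hupd l hl'] at hkl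
        exact hi (by simpa using hk') (by simpa using hl') hkl
      · rw [hupd k hk', Function.update_self] at hkl
        exact absurd hkl (Finset.ne_of_mem_erase (his k hk'))
      · rw [hupd l hl', Function.update_self] at hkl
        exact absurd hkl.symm (Finset.ne_of_mem_erase (his l hl'))
      · rfl
    · intro k hk
      rcases Nat.lt_succ_iff_lt_or_eq.1 hk with hk' | rfl
      · rw [hupd k hk']
        exact Finset.mem_of_mem_erase (his k hk')
      · rwa [Function.update_self]
    · have h1 : ∑ k ∈ s, a k * b k =
          (∑ k ∈ s.erase k₀, a k * (b k - b k₀)) + b k₀ * ∑ k ∈ s, a k := by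
        rw [← Finset.sum_erase_add _ _ hk₀, ← Finset.sum_erase_add s a hk₀, mul_add,
          Finset.mul_sum, ← add_assoc, ← Finset.sum_add_distrib]
        congr 1
        · exact Finset.sum_congr rfl fun k _ => by ring
        · ring
      have h2 : ∑ k ∈ Finset.range m, w k * b (Function.update i m k₀ k) =
          ∑ k ∈ Finset.range m, w k * b (i k) :=
        Finset.sum_congr rfl fun k hk => by rw [hupd k (Finset.mem_range.1 hk)]
      have h3 := mul_le_mul_of_nonneg_left (hA s subset_rfl) (hb k₀ hk₀)
      rw [hs, Finset.sum_range_succ] at h3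
      rw [h1, Finset.sum_range_succ, h2, Function.update_self]
      simp only [mul_sub, Finset.sum_sub_distrib, ← Finset.sum_mul] at hsum
      simp only [mul_sub, Finset.sum_sub_distrib, ← Finset.sum_mul]
      linarith

/-- The rearranged weighted sums `∑ w k • x (i k)` are bounded by `C`, uniformly in the signs. -/
def RearrangementBounded {Y : Type*} [NormedAddCommGroup Y] [NormedSpace ℝ Y]
    (w : ℕ → ℝ) (C : ℝ) (x : ℕ → Y) : Prop :=
  ∀ (n : ℕ) (i : ℕ → ℕ), Set.InjOn i (Finset.range n) → ∀ f : Y →L[ℝ] ℝ, ‖f‖ ≤ 1 →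
    ∑ k ∈ Finset.range n, w k * |f (x (i k))| ≤ C

theorem RearrangementBounded.norm_linearCombination_le {Y : Type*} [NormedAddCommGroup Y]
    [NormedSpace ℝ Y] {w : ℕ → ℝ} (hw : ∀ k, 0 < w k) {C : ℝ} {x : ℕ → Y}
    (h : RearrangementBounded w C x) (a : ℕ →₀ ℝ) :
    ‖Finsupp.linearCombination ℝ x a‖ ≤ C * ‖lorentzIncl.{v} hw a‖ := by
  obtain ⟨f, hf1, hf⟩ := exists_dual_vector'' ℝ (Finsupp.linearCombination ℝ x a)
  have hR : ∀ A ⊆ a.support, ∑ k ∈ A, |a k| ≤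
      ‖lorentzIncl.{v} hw a‖ * ∑ k ∈ Finset.range A.card, w k := by
    intro A _
    choose ε hε using fun k => exists_units_mul_eq_abs (a k)
    have h1 := weight_mul_lorentzEmbed_apply.{v} hw a A ε
    rw [Finset.sum_congr rfl fun k _ => hε k] at h1
    rw [← h1, mul_comm]
    gcongr
    · exact Finset.sum_nonneg fun k _ => (hw k).le
    · exact (le_abs_self _).trans (LorentzPredual.abs_apply_le hw (lorentzIncl.{v} hw a) _)
  obtain ⟨i, hi, -, hsum⟩ := exists_enum_sum_mul_le (fun k => |a k|) _ a.support rfl hR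
    (fun k => |f (x k)|) fun k _ => abs_nonneg _
  have hf' : f (Finsupp.linearCombination ℝ x a) ≤ ∑ k ∈ a.support, |a k| * |f (x k)| := by
    rw [Finsupp.linearCombination_apply, Finsupp.sum, map_sum]
    refine Finset.sum_le_sum fun k _ => ?_
    rw [map_smul, smul_eq_mul, ← abs_mul]
    exact le_abs_self _
  have hf2 : ‖Finsupp.linearCombination ℝ x a‖ = f (Finsupp.linearCombination ℝ x a) := by
    rw [hf]; rfl
  rw [hf2, mul_comm]
  exact hf'.trans (hsum.trans (by gcongr; exact h _ i hi f hf1))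

theorem not_propertyB_of_rearrangementBounded {Y : Type u} [NormedAddCommGroup Y]
    [NormedSpace ℝ Y] [CompleteSpace Y] (hY : LocallyAMUC Y) {x : ℕ → Y} (hx : NormalizedSeq x)
    {w : ℕ → ℝ} (hw : ∀ k, 0 < w k) (hanti : Antitone w)
    (hinf : Tendsto (fun n => ∑ k ∈ Finset.range n, w k) atTop atTop) {C : ℝ}
    (hC : RearrangementBounded w C x) : ¬ PropertyB.{v, u} Y := by
  intro hB
  have : CompleteSpace (LorentzPredual.{v} hw) :=
    (Submodule.isClosed_topologicalClosure _).completeSpace_coe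
  set T := (Finsupp.linearCombination ℝ x).extendOfNorm (lorentzIncl.{v} hw) with hT
  have hTe : ∀ n, T (lorentzIncl hw (Finsupp.single n 1)) = x n := by
    intro n
    rw [hT, LinearMap.extendOfNorm_eq (denseRange_lorentzIncl hw)
      ⟨C, hC.norm_linearCombination_le hw⟩]
    simp
  have he : ∀ n, ‖lorentzIncl.{v} hw (Finsupp.single n 1)‖ ≤ 1 / w 0 := by
    intro n
    have := norm_lorentzIncl_le_of_abs_le.{v} hw hanti (Finsupp.single n 1) (s := {n})
      (by simp) (by simp) (by intro k hk; simpa [Finsupp.single_apply, eq_comm] using hk)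
    simpa using this
  obtain ⟨S, hS, hdist⟩ := (hB (LorentzPredual.{v} hw)).exists_dist_lt T (ε := w 0 / 2)
    (half_pos (hw 0))
  obtain ⟨n, hn⟩ := hS.exists_norm_lt hY (tendsto_dual_lorentzIncl_single hw hanti hinf)
    (fun y hy => LorentzPredual.exists_flat hw hanti hinf y hy) (r := 1 / 2) (by norm_num)
  have h1 : ‖(T - S) (lorentzIncl hw (Finsupp.single n 1))‖ ≤ 1 / 2 := by
    have hdist : ‖T - S‖ < w 0 / 2 := (dist_eq_norm T S).symm.trans_lt hdist
    refine ((T - S).le_opNorm _).trans ?_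
    calc ‖T - S‖ * ‖lorentzIncl.{v} hw (Finsupp.single n 1)‖ ≤ (w 0 / 2) * (1 / w 0) :=
          mul_le_mul hdist.le (he n) (norm_nonneg _) (half_pos (hw 0)).le
      _ = 1 / 2 := by have := (hw 0).ne'; field_simp
  rw [sub_apply, hTe] at h1
  have h2 := norm_sub_norm_le (x n) (S (lorentzIncl hw (Finsupp.single n 1)))
  rw [hx n] at h2
  linarith

theorem HasUpperEstimates.exists_rearrangementBounded {Y : Type*} [NormedAddCommGroup Y]
    [NormedSpace ℝ Y] {p : ℝ} (hp : 1 < p) {x : ℕ → Y} (h : HasUpperEstimates p x) :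
    ∃ C, RearrangementBounded (fun k => 1 / ((k : ℝ) + 1)) C x := by
  obtain ⟨C, hC, hCx⟩ := h
  have hp0 : p ≠ 0 := by linarith
  have hsummable : Summable fun k : ℕ => (1 / ((k : ℝ) + 1)) ^ p := by
    have := (summable_nat_add_iff 1).2 (Real.summable_one_div_nat_rpow.2 hp)
    refine this.congr fun k => ?_
    rw [Real.div_rpow zero_le_one (by positivity), Real.one_rpow]
    push_cast
    rfl
  refine ⟨C * (∑' k : ℕ, (1 / ((k : ℝ) + 1)) ^ p) ^ (1 / p), fun n i hi f hf => ?_⟩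
  choose ε hε using fun k => exists_units_mul_eq_abs (f (x (i k)))
  set g := Function.invFunOn i (Finset.range n : Set ℕ) with hg
  have hgi : ∀ k ∈ Finset.range n, g (i k) = k := fun k hk =>
    hi.leftInvOn_invFunOn (Finset.mem_coe.2 hk)
  set s := (Finset.range n).image i with hs
  set a : ℕ → ℝ := fun j => if j ∈ s then ((ε (g j) : ℤ) : ℝ) * (1 / ((g j : ℝ) + 1)) else 0
    with ha
  have hai : ∀ k ∈ Finset.range n, a (i k) = ((ε k : ℤ) : ℝ) * (1 / ((k : ℝ) + 1)) := by
    intro k hk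
    rw [ha]
    simp only
    rw [if_pos (Finset.mem_image_of_mem i hk), hgi k hk]
  have ha0 : ∀ j ∉ s, a j = 0 := fun j hj => if_neg hj
  set N := s.sup id + 1 with hN
  have hsN : s ⊆ Finset.range N := fun j hj =>
    Finset.mem_range.2 (Nat.lt_succ_of_le (Finset.le_sup (f := id) hj))
  have h1 : ∑ j ∈ Finset.range N, a j • x j =
      ∑ k ∈ Finset.range n, (((ε k : ℤ) : ℝ) * (1 / ((k : ℝ) + 1))) • x (i k) := by
    rw [← Finset.sum_subset hsN fun j _ hj => by rw [ha0 j hj, zero_smul],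
      Finset.sum_image hi]
    exact Finset.sum_congr rfl fun k hk => by rw [hai k hk]
  have h2 : ∑ j ∈ Finset.range N, |a j| ^ p =
      ∑ k ∈ Finset.range n, (1 / ((k : ℝ) + 1)) ^ p := by
    rw [← Finset.sum_subset hsN fun j _ hj => by rw [ha0 j hj, abs_zero, Real.zero_rpow hp0],
      Finset.sum_image hi]
    refine Finset.sum_congr rfl fun k hk => ?_
    have hk0 : (0 : ℝ) < 1 / ((k : ℝ) + 1) := by positivity
    rw [hai k hk, abs_mul, abs_of_pos hk0]
    rcases Int.units_eq_one_or (ε k) with h | h <;> simp [h]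
  have h3 : ∑ k ∈ Finset.range n, 1 / ((k : ℝ) + 1) * |f (x (i k))| =
      f (∑ j ∈ Finset.range N, a j • x j) := by
    rw [h1, map_sum]
    refine Finset.sum_congr rfl fun k _ => ?_
    rw [map_smul, smul_eq_mul, ← hε k]
    ring
  rw [h3]
  refine (le_abs_self _).trans ((f.le_of_opNorm_le hf _).trans ?_)
  rw [one_mul]
  refine (hCx N a).trans ?_
  rw [h2]
  gcongr
  exact hsummable.sum_le_tsum _ fun k _ => by positivity

theorem tendsto_sum_range_one_div_add_one_atTop :
    Tendsto (fun n => ∑ k ∈ Finset.range n, 1 / ((k : ℝ) + 1)) atTop atTop :=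
  Real.tendsto_sum_range_one_div_nat_succ_atTop

theorem antitone_one_div_add_one : Antitone fun k : ℕ => 1 / ((k : ℝ) + 1) :=
  fun _ _ h => one_div_le_one_div_of_le (by positivity) (by gcongr)

/-- Baire category in the Polish space of permutations of `ℕ`. -/
theorem exists_perm_of_closed_cover {P : ℕ → (ℕ → ℕ) → Prop} (hP : ∀ M, IsClosed {s | P M s})
    (h : ∀ σ : Equiv.Perm ℕ, ∃ M, P M σ) :
    ∃ (M : ℕ) (σ₀ : Equiv.Perm ℕ) (D : Finset ℕ),
      ∀ σ : Equiv.Perm ℕ, (∀ k ∈ D, σ k = σ₀ k) → P M σ := by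
  have hev : ∀ k : ℕ, Continuous fun q : (ℕ → ℕ) × (ℕ → ℕ) => q.1 (q.2 k) := by
    refine fun k => continuous_iff_continuousAt.2 fun q => ?_
    have h1 : Continuous fun r : (ℕ → ℕ) × (ℕ → ℕ) => r.1 (q.2 k) := by fun_prop
    have h2 : Continuous fun r : (ℕ → ℕ) × (ℕ → ℕ) => r.2 k := by fun_prop
    refine h1.continuousAt.congr ?_
    have : ∀ᶠ r in 𝓝 q, r.2 k = q.2 k :=
      h2.continuousAt.eventually ((isOpen_discrete {q.2 k}).mem_nhds rfl)
    filter_upwards [this] with r hr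
    rw [hr]
  have hev' : ∀ k : ℕ, Continuous fun q : (ℕ → ℕ) × (ℕ → ℕ) => q.2 (q.1 k) := fun k =>
    (hev k).comp continuous_swap
  set G : Set ((ℕ → ℕ) × (ℕ → ℕ)) := {q | (∀ k, q.1 (q.2 k) = k) ∧ ∀ k, q.2 (q.1 k) = k} with hG
  have hGclosed : IsClosed G := by
    rw [hG, Set.ofPred_and, Set.ofPred_forall, Set.ofPred_forall]
    exact (isClosed_iInter fun k => isClosed_eq (hev k) continuous_const).inter
      (isClosed_iInter fun k => isClosed_eq (hev' k) continuous_const)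
  have : PolishSpace G := hGclosed.polishSpace
  have : Nonempty G := ⟨⟨(id, id), fun _ => rfl, fun _ => rfl⟩⟩
  have hcl : ∀ M, IsClosed {q : G | P M q.1.1} := fun M =>
    (hP M).preimage (continuous_fst.comp continuous_subtype_val)
  have hcover : ⋃ M, {q : G | P M q.1.1} = Set.univ := by
    refine Set.eq_univ_of_forall fun q => Set.mem_iUnion.2 ?_
    exact h ⟨q.1.1, q.1.2, q.2.2, q.2.1⟩
  obtain ⟨M, ⟨⟨s, t⟩, hst⟩, hq⟩ := nonempty_interior_of_iUnion_of_closed hcl hcover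
  rw [mem_interior_iff_mem_nhds, mem_nhds_subtype] at hq
  obtain ⟨U, hU, hUM⟩ := hq
  rw [mem_nhds_prod_iff] at hU
  obtain ⟨U₁, hU₁, U₂, hU₂, hUU⟩ := hU
  rw [nhds_pi, Filter.mem_pi] at hU₁ hU₂
  obtain ⟨I₁, hI₁, V₁, hV₁, hIV₁⟩ := hU₁
  obtain ⟨I₂, hI₂, V₂, hV₂, hIV₂⟩ := hU₂
  refine ⟨M, ⟨s, t, hst.2, hst.1⟩, hI₁.toFinset ∪ hI₂.toFinset.image t, fun σ hσ => ?_⟩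
  have hσG : ((σ : ℕ → ℕ), (σ.symm : ℕ → ℕ)) ∈ G := ⟨σ.apply_symm_apply, σ.symm_apply_apply⟩
  refine hUM (show (⟨_, hσG⟩ : G) ∈ _ from hUU ⟨hIV₁ fun k hk => ?_, hIV₂ fun k hk => ?_⟩)
  · have h1 : σ k = s k := hσ k (by simp [hk])
    change σ k ∈ V₁ k
    rw [h1]
    exact mem_of_mem_nhds (hV₁ k)
  · have h1 : σ (t k) = s (t k) :=
      hσ (t k) (Finset.mem_union_right _ (Finset.mem_image_of_mem t (by simpa using hk)))
    have h3 : s (t k) = k := hst.1 k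
    have h2 : σ.symm k = t k := by rw [Equiv.symm_apply_eq, h1, h3]
    change σ.symm k ∈ V₂ k
    rw [h2]
    exact mem_of_mem_nhds (hV₂ k)

section SymmetricSequences

variable {Y : Type*} [NormedAddCommGroup Y] [NormedSpace ℝ Y]

theorem IsBasicSeq.exists_norm_sum_filter_le [CompleteSpace Y] {x : ℕ → Y} (hx : IsBasicSeq x) :
    ∃ B : ℝ, 0 ≤ B ∧ ∀ (s : Finset ℕ) (a : ℕ → ℝ) (j : ℕ → ℕ) (N : ℕ),
      ‖∑ k ∈ s with j k < N, a k • x (j k)‖ ≤ B * ‖∑ k ∈ s, a k • x (j k)‖ := by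
  obtain ⟨b, hb⟩ := hx
  have : CompleteSpace (closedSpan x) :=
    (Submodule.isClosed_topologicalClosure _).completeSpace_coe
  obtain ⟨B, hB⟩ := b.exists_norm_proj_le
  refine ⟨B, (norm_nonneg _).trans (hB 0), fun s a j N => ?_⟩
  have h1 : ∀ S : Finset ℕ, ((∑ k ∈ S, a k • b (j k) : closedSpan x) : Y) =
      ∑ k ∈ S, a k • x (j k) := by
    intro S
    rw [AddSubmonoidClass.coe_finsetSum]
    exact Finset.sum_congr rfl fun k _ => by rw [Submodule.coe_smul, hb]
  have h2 : b.proj N (∑ k ∈ s, a k • b (j k)) = ∑ k ∈ s with j k < N, a k • b (j k) := by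
    rw [map_sum, Finset.sum_filter]
    refine Finset.sum_congr rfl fun k _ => ?_
    rw [map_smul, SchauderBasis.proj_apply_basis_mem, smul_ite, smul_zero]
  rw [← h1, ← h1, ← h2]
  exact (b.proj N).le_of_opNorm_le (hB N) _

/-- Finite sums do not change when the coefficients are extended by zero to an initial segment. -/
theorem sum_range_ite_mem {s : Finset ℕ} {n : ℕ} (hs : s ⊆ Finset.range n) (a : ℕ → ℝ)
    (y : ℕ → Y) :
    ∑ k ∈ Finset.range n, (if k ∈ s then a k else 0) • y k = ∑ k ∈ s, a k • y k := by
  rw [← Finset.sum_subset hs fun k _ hk => by rw [if_neg hk, zero_smul]]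
  exact Finset.sum_congr rfl fun k hk => by rw [if_pos hk]

theorem IsSymmetricBasicSeq.exists_norm_sum_injOn_le [CompleteSpace Y] {x : ℕ → Y}
    (hx1 : NormalizedSeq x) (hx : IsSymmetricBasicSeq x) :
    ∃ K : ℝ, 0 ≤ K ∧ ∀ (A : Finset ℕ) (a : ℕ → ℝ) (i : ℕ → ℕ), Set.InjOn i A →
      ‖∑ k ∈ A, a k • x (i k)‖ ≤ K * ‖∑ k ∈ A, a k • x k‖ := by
  obtain ⟨B, hB0, hB⟩ := hx.1.exists_norm_sum_filter_le
  obtain ⟨M, σ₀, D, hD⟩ := exists_perm_of_closed_cover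
    (P := fun M s => ∀ (n : ℕ) (a : ℕ → ℝ), ‖∑ k ∈ Finset.range n, a k • x (s k)‖ ≤
      M * ‖∑ k ∈ Finset.range n, a k • x k‖)
    (fun M => by
      simp only [Set.ofPred_forall]
      refine isClosed_iInter fun n => isClosed_iInter fun a => isClosed_le ?_ continuous_const
      refine (continuous_finsetSum _ fun k _ => ?_).norm
      exact ((continuous_of_discreteTopology (f := x)).comp (continuous_apply k)).const_smul _)
    (fun σ => by
      obtain ⟨c, hc, _, _, h⟩ := (hx.2 σ).2
      obtain ⟨M, hM⟩ := exists_nat_ge (1 / c)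
      refine ⟨M, fun n a => ?_⟩
      have h1 := (h n a).1
      have h2 : ‖∑ k ∈ Finset.range n, a k • x (σ k)‖ ≤
          1 / c * ‖∑ k ∈ Finset.range n, a k • x k‖ := by
        rw [one_div, le_inv_mul_iff₀ hc]
        exact h1
      exact h2.trans (by gcongr))
  have hcoef : ∀ (A : Finset ℕ) (a : ℕ → ℝ), ∀ k ∈ A, |a k| ≤ 2 * B * ‖∑ l ∈ A, a l • x l‖ := by
    intro A a k hk
    have h1 := hB A a id (k + 1)
    have h2 := hB A a id k
    simp only [id] at h1 h2
    have h3 : (∑ l ∈ A with l < k + 1, a l • x l) - ∑ l ∈ A with l < k, a l • x l =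
        a k • x k := by
      have : A.filter (· < k + 1) = insert k (A.filter (· < k)) := by
        ext l
        simp only [Finset.mem_filter, Finset.mem_insert]
        constructor
        · rintro ⟨hl, hlk⟩
          rcases Nat.lt_succ_iff_lt_or_eq.1 hlk with h | h
          · exact Or.inr ⟨hl, h⟩
          · exact Or.inl h
        · rintro (rfl | ⟨hl, hlk⟩)
          · exact ⟨hk, Nat.lt_succ_self _⟩
          · exact ⟨hl, hlk.trans (Nat.lt_succ_self _)⟩
      rw [this, Finset.sum_insert (by simp), add_sub_cancel_right]
    have h4 : ‖a k • x k‖ = |a k| := by rw [norm_smul, hx1 k, mul_one, Real.norm_eq_abs]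
    rw [← h4, ← h3]
    refine (norm_sub_le _ _).trans ?_
    linarith
  refine ⟨(2 * D.card) * (2 * B) + M * (1 + (2 * D.card) * (2 * B)), by positivity,
    fun A a i hi => ?_⟩
  set z := ∑ k ∈ A, a k • x k with hz
  set F := A.filter (fun k => k ∈ D ∨ i k ∈ D.image σ₀) with hF
  set A' := A.filter (fun k => ¬(k ∈ D ∨ i k ∈ D.image σ₀)) with hA'
  have hFcard : (F.card : ℝ) ≤ 2 * D.card := by
    have h1 : F = A.filter (· ∈ D) ∪ A.filter (fun k => i k ∈ D.image σ₀) := Finset.filter_or ..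
    have h2 : (A.filter (· ∈ D)).card ≤ D.card :=
      Finset.card_le_card fun k hk => (Finset.mem_filter.1 hk).2
    have h3 : (A.filter (fun k => i k ∈ D.image σ₀)).card ≤ D.card :=
      (Finset.card_le_card_of_injOn i (fun k hk => (Finset.mem_filter.1 hk).2)
        (hi.mono fun k hk => (Finset.mem_filter.1 hk).1)).trans Finset.card_image_le
    have h4 := Finset.card_union_le (A.filter (· ∈ D)) (A.filter (fun k => i k ∈ D.image σ₀))
    rw [← h1] at h4
    exact_mod_cast (by omega : F.card ≤ 2 * D.card)
  have hFnorm : ∀ j : ℕ → ℕ, ‖∑ k ∈ F, a k • x (j k)‖ ≤ (2 * D.card) * (2 * B) * ‖z‖ := by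
    intro j
    refine (norm_sum_le_of_le _ (n := fun _ => 2 * B * ‖z‖) fun k hk => ?_).trans ?_
    · rw [norm_smul, hx1, mul_one, Real.norm_eq_abs]
      exact hcoef A a k (Finset.mem_filter.1 hk).1
    · rw [Finset.sum_const, nsmul_eq_mul, mul_assoc _ (2 * B)]
      gcongr
  have hsplit : ∀ y : ℕ → Y, ∑ k ∈ F, y k + ∑ k ∈ A', y k = ∑ k ∈ A, y k := fun y =>
    Finset.sum_filter_add_sum_filter_not A _ y
  have hdisj : ∀ k ∈ A', k ∈ A ∧ k ∉ D ∧ i k ∉ D.image σ₀ := by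
    intro k hk
    rw [hA', Finset.mem_filter, not_or] at hk
    exact hk
  obtain ⟨σ, hσ⟩ := Equiv.Perm.exists_extending_pair
    (fun k : ↥(D ∪ A') => (k : ℕ)) (fun k => if (k : ℕ) ∈ D then σ₀ k else i k)
    Subtype.val_injective (by
      rintro ⟨k, hk⟩ ⟨l, hl⟩ hkl
      simp only at hkl
      refine Subtype.ext ?_
      change k = l
      rw [Finset.mem_union] at hk hl
      split_ifs at hkl with h1 h2 h2
      · exact σ₀.injective hkl
      · exact absurd (hkl ▸ Finset.mem_image_of_mem σ₀ h1) (hdisj l (hl.resolve_left h2)).2.2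
      · exact absurd (hkl ▸ Finset.mem_image_of_mem σ₀ h2) (hdisj k (hk.resolve_left h1)).2.2
      · exact hi (hdisj k (hk.resolve_left h1)).1 (hdisj l (hl.resolve_left h2)).1 hkl)
  have hσD : ∀ k ∈ D, σ k = σ₀ k := fun k hk => by
    have := hσ ⟨k, Finset.mem_union_left _ hk⟩
    simpa [hk] using this
  have hσA : ∀ k ∈ A', σ k = i k := fun k hk => by
    have := hσ ⟨k, Finset.mem_union_right _ hk⟩
    simpa [(hdisj k hk).2.1] using this
  have hA'n : A' ⊆ Finset.range (A'.sup id + 1) := fun k hk =>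
    Finset.mem_range.2 (Nat.lt_succ_of_le (Finset.le_sup (f := id) hk))
  have hmain := hD σ hσD (A'.sup id + 1) (fun k => if k ∈ A' then a k else 0)
  rw [sum_range_ite_mem hA'n a fun k => x (σ k), sum_range_ite_mem hA'n,
    Finset.sum_congr rfl fun k hk => by rw [hσA k hk]] at hmain
  have hA'norm : ‖∑ k ∈ A', a k • x k‖ ≤ (1 + (2 * D.card) * (2 * B)) * ‖z‖ := by
    have h1 : ∑ k ∈ A', a k • x k = z - ∑ k ∈ F, a k • x k := by
      rw [hz, ← hsplit, add_sub_cancel_left]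
    rw [h1]
    refine (norm_sub_le _ _).trans ?_
    have := hFnorm id
    simp only [id] at this
    linarith
  rw [← hsplit]
  refine (norm_add_le _ _).trans ?_
  rw [add_mul, mul_assoc (M : ℝ)]
  exact add_le_add (hFnorm i) (hmain.trans (by gcongr))

/-- Symmetric basic sequences are uniformly unconditional and uniformly symmetric. -/
theorem IsSymmetricBasicSeq.exists_norm_sum_subset_le [CompleteSpace Y] {x : ℕ → Y}
    (hx1 : NormalizedSeq x) (hx : IsSymmetricBasicSeq x) :
    ∃ K : ℝ, 0 < K ∧ ∀ (A B : Finset ℕ) (a : ℕ → ℝ) (i : ℕ → ℕ), A ⊆ B → Set.InjOn i A →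
      ‖∑ k ∈ A, a k • x (i k)‖ ≤ K * ‖∑ k ∈ B, a k • x k‖ := by
  obtain ⟨C, hC0, hC⟩ := hx.1.exists_norm_sum_filter_le
  obtain ⟨K, hK0, hK⟩ := hx.exists_norm_sum_injOn_le hx1
  refine ⟨K * (C * K) + 1, by positivity, fun A B a i hAB hi => ?_⟩
  set N := B.sup id + 1 with hN
  have hBN : ∀ k ∈ B, k < N := fun k hk => Nat.lt_succ_of_le (Finset.le_sup (f := id) hk)
  set j : ℕ → ℕ := fun k => if k ∈ A then k else k + N with hj
  have hjB : Set.InjOn j B := by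
    intro k hk l hl hkl
    have hk := hBN k hk
    have hl := hBN l hl
    simp only [hj] at hkl
    split_ifs at hkl <;> omega
  have h1 := hC B a j N
  have h2 : ∑ k ∈ B with j k < N, a k • x (j k) = ∑ k ∈ A, a k • x k := by
    have : B.filter (fun k => j k < N) = A := by
      ext k
      rw [Finset.mem_filter]
      by_cases hk : k ∈ A
      · simp [hj, hk, hAB hk, hBN k (hAB hk)]
      · simp [hj, hk]
    rw [this]
    exact Finset.sum_congr rfl fun k hk => by simp [hj, hk]
  rw [h2] at h1
  calc ‖∑ k ∈ A, a k • x (i k)‖ ≤ K * ‖∑ k ∈ A, a k • x k‖ := hK A a i hi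
    _ ≤ K * (C * (K * ‖∑ k ∈ B, a k • x k‖)) := by
      gcongr
      exact h1.trans (by gcongr; exact hK B a j hjB)
    _ ≤ _ := by
      have := norm_nonneg (∑ k ∈ B, a k • x k)
      linarith

theorem norm_sum_smul_l1UnitVector (n : ℕ) (a : ℕ → ℝ) :
    ‖∑ k ∈ Finset.range n, a k • l1UnitVector k‖ = ∑ k ∈ Finset.range n, |a k| := by
  have h1 : ∑ k ∈ Finset.range n, a k • l1UnitVector k =
      ∑ k ∈ Finset.range n, lp.single (E := fun _ : ℕ => ℝ) 1 k (a k) := by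
    refine Finset.sum_congr rfl fun k _ => ?_
    rw [l1UnitVector, ← lp.single_smul, smul_eq_mul, mul_one]
  have h2 := lp.norm_sum_single (E := fun _ : ℕ => ℝ) (p := 1) (by simp) a (Finset.range n)
  rw [h1]
  simpa using h2

theorem seqEquivalent_l1_of_le_norm_sum {x : ℕ → Y} (hx1 : NormalizedSeq x) {K : ℝ} (hK0 : 0 < K)
    (hK : ∀ (A B : Finset ℕ) (a : ℕ → ℝ) (i : ℕ → ℕ), A ⊆ B → Set.InjOn i A →
      ‖∑ k ∈ A, a k • x (i k)‖ ≤ K * ‖∑ k ∈ B, a k • x k‖) {c : ℝ} (hc : 0 < c)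
    (hlow : ∀ n : ℕ, c * n ≤ ‖∑ k ∈ Finset.range n, x k‖) : SeqEquivalent x l1UnitVector := by
  have hpos : ∀ (A B : Finset ℕ) (a : ℕ → ℝ), A ⊆ B → (∀ k ∈ A, 0 ≤ a k) →
      c / 2 * ∑ k ∈ A, a k ≤ K * ‖∑ k ∈ B, a k • x k‖ := by
    intro A B a hAB ha
    obtain ⟨N, hN⟩ := exists_nat_ge (A.card / (c / 2))
    obtain ⟨f, hf1, hf⟩ := exists_dual_vector'' ℝ (∑ k ∈ Finset.range N, x k)
    have hfx : ∀ k, f (x k) ≤ 1 := fun k =>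
      (le_abs_self _).trans ((f.le_of_opNorm_le hf1 _).trans (by rw [hx1 k, mul_one]))
    set P := (Finset.range N).filter (fun k => c / 2 ≤ f (x k)) with hP
    have hcard : A.card ≤ P.card := by
      have h1 : ∑ k ∈ Finset.range N, f (x k) ≤
          ∑ k ∈ Finset.range N, ((if c / 2 ≤ f (x k) then 1 else 0) + c / 2) := by
        refine Finset.sum_le_sum fun k _ => ?_
        split_ifs with h
        · linarith [hfx k]
        · linarith
      rw [← map_sum, hf, Finset.sum_add_distrib, Finset.sum_boole, Finset.sum_const,
        Finset.card_range, nsmul_eq_mul] at h1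
      have h2 := hlow N
      rw [div_le_iff₀ (half_pos hc)] at hN
      have h3 : (‖∑ k ∈ Finset.range N, x k‖ : ℝ) ≤ P.card + N * (c / 2) := h1
      have : (A.card : ℝ) ≤ P.card := by linarith
      exact_mod_cast this
    obtain ⟨i, hiP, hi⟩ : ∃ i : ℕ → ℕ, (∀ k ∈ A, i k ∈ P) ∧ Set.InjOn i A := by
      obtain ⟨P', hP', hP'c⟩ := Finset.exists_subset_card_eq hcard
      refine ⟨fun k => if h : k ∈ A then (A.equivOfCardEq hP'c.symm ⟨k, h⟩ : ℕ) else 0, ?_, ?_⟩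
      · intro k hk
        simp only [dif_pos hk]
        exact hP' (A.equivOfCardEq hP'c.symm ⟨k, hk⟩).2
      · intro k hk l hl hkl
        simp only [dif_pos (Finset.mem_coe.1 hk), dif_pos (Finset.mem_coe.1 hl)] at hkl
        have := (A.equivOfCardEq hP'c.symm).injective (Subtype.ext hkl)
        simpa using this
    calc c / 2 * ∑ k ∈ A, a k ≤ f (∑ k ∈ A, a k • x (i k)) := by
          rw [map_sum, Finset.mul_sum]
          refine Finset.sum_le_sum fun k hk => ?_
          rw [map_smul, smul_eq_mul, mul_comm]
          exact mul_le_mul_of_nonneg_left (Finset.mem_filter.1 (hiP k hk)).2 (ha k hk)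
      _ ≤ ‖∑ k ∈ A, a k • x (i k)‖ :=
          (le_abs_self _).trans ((f.le_of_opNorm_le hf1 _).trans (by rw [one_mul]))
      _ ≤ _ := hK A B a i hAB hi
  refine ⟨1, one_pos, 4 * K / c, by positivity, fun n a => ?_⟩
  rw [norm_sum_smul_l1UnitVector]
  constructor
  · rw [one_mul]
    refine norm_sum_le_of_le _ fun k _ => ?_
    rw [norm_smul, hx1 k, mul_one, Real.norm_eq_abs]
  · have h1 := hpos ((Finset.range n).filter (fun k => 0 ≤ a k)) (Finset.range n) a
      (Finset.filter_subset _ _) fun k hk => (Finset.mem_filter.1 hk).2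
    have h2 := hpos ((Finset.range n).filter (fun k => ¬0 ≤ a k)) (Finset.range n)
      (fun k => -a k) (Finset.filter_subset _ _) fun k hk => by
        have := (Finset.mem_filter.1 hk).2
        linarith
    have h3 : ∑ k ∈ Finset.range n, |a k| =
        (∑ k ∈ Finset.range n with 0 ≤ a k, a k) + ∑ k ∈ Finset.range n with ¬0 ≤ a k, -a k := by
      rw [← Finset.sum_filter_add_sum_filter_not (Finset.range n) (fun k => 0 ≤ a k)]
      congr 1
      · exact Finset.sum_congr rfl fun k hk => abs_of_nonneg (Finset.mem_filter.1 hk).2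
      · exact Finset.sum_congr rfl fun k hk => abs_of_neg (not_le.1 (Finset.mem_filter.1 hk).2)
    simp only [neg_smul, Finset.sum_neg_distrib, norm_neg] at h2
    rw [Finset.sum_neg_distrib] at h3
    rw [h3, div_mul_eq_mul_div, le_div_iff₀ hc]
    linarith

theorem sum_abs_dual_le_two_mul {y : ℕ → Y} {s : Finset ℕ} {R : ℝ}
    (h : ∀ A ⊆ s, ‖∑ k ∈ A, y k‖ ≤ R) {f : Y →L[ℝ] ℝ} (hf : ‖f‖ ≤ 1) :
    ∑ k ∈ s, |f (y k)| ≤ 2 * R := by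
  have key : ∀ A ⊆ s, |∑ k ∈ A, f (y k)| ≤ R := fun A hA => by
    rw [← map_sum]
    exact (f.le_of_opNorm_le hf _).trans ((one_mul _).trans_le (h A hA))
  rw [← Finset.sum_filter_add_sum_filter_not s (fun k => 0 ≤ f (y k)), two_mul]
  refine add_le_add ?_ ?_
  · rw [Finset.sum_congr rfl fun k hk => abs_of_nonneg (Finset.mem_filter.1 hk).2]
    exact (le_abs_self _).trans (key _ (Finset.filter_subset _ _))
  · rw [Finset.sum_congr rfl fun k hk => abs_of_neg (not_le.1 (Finset.mem_filter.1 hk).2),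
      Finset.sum_neg_distrib]
    exact (neg_le_abs _).trans (key _ (Finset.filter_subset _ _))

theorem exists_weight_rearrangementBounded {x : ℕ → Y} (hx1 : NormalizedSeq x) {K : ℝ}
    (hK0 : 0 < K)
    (hK : ∀ (A B : Finset ℕ) (a : ℕ → ℝ) (i : ℕ → ℕ), A ⊆ B → Set.InjOn i A →
      ‖∑ k ∈ A, a k • x (i k)‖ ≤ K * ‖∑ k ∈ B, a k • x k‖)
    (hsmall : ∀ c > (0 : ℝ), ∃ n : ℕ, ‖∑ k ∈ Finset.range n, x k‖ < c * n) :
    ∃ w : ℕ → ℝ, (∀ k, 0 < w k) ∧ Antitone w ∧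
      Tendsto (fun n => ∑ k ∈ Finset.range n, w k) atTop atTop ∧
      ∃ C, RearrangementBounded w C x := by
  choose N hN using fun j : ℕ => hsmall ((1 / 2) ^ j) (by positivity)
  have hN0 : ∀ j, 0 < N j := by
    refine fun j => Nat.pos_of_ne_zero fun h => ?_
    have := hN j
    rw [h] at this
    simp at this
  have hN0' : ∀ j, (0 : ℝ) < N j := fun j => by exact_mod_cast hN0 j
  have hKN : ∀ (j : ℕ) (A : Finset ℕ) (i : ℕ → ℕ), A ⊆ Finset.range (N j) → Set.InjOn i A →
      ‖∑ k ∈ A, x (i k)‖ ≤ K * ((1 / 2) ^ j * N j) := by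
    intro j A i hA hi
    have := hK A _ (fun _ => 1) i hA hi
    simp only [one_smul] at this
    exact this.trans (mul_le_mul_of_nonneg_left (hN j).le hK0.le)
  have hinv : ∀ j, 1 / (N j : ℝ) ≤ K * (1 / 2) ^ j := by
    intro j
    have := hKN j {0} id (by simpa using hN0 j) (by simp)
    rw [Finset.sum_singleton, id, hx1 0] at this
    rw [div_le_iff₀ (hN0' j)]
    linarith
  set v : ℕ → ℕ → ℝ := fun j k => if k < N j then 1 / (N j : ℝ) else 0 with hv
  have hv0 : ∀ j k, 0 ≤ v j k := fun j k => by
    simp only [hv]; split_ifs <;> positivity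
  have hgeom : Summable fun j : ℕ => K * (1 / 2 : ℝ) ^ j := summable_geometric_two.mul_left K
  have hvs : ∀ k, Summable fun j => v j k := by
    refine fun k => Summable.of_nonneg_of_le (fun j => hv0 j k) (fun j => ?_) hgeom
    simp only [hv]
    split_ifs
    · exact hinv j
    · positivity
  refine ⟨fun k => ∑' j, v j k, fun k => ?_, fun k l hkl => ?_, ?_,
    ∑' j : ℕ, 2 * (K * (1 / 2) ^ j), ?_⟩
  · have hlim : Tendsto (fun j : ℕ => K * (1 / 2 : ℝ) ^ j) atTop (𝓝 0) :=
      hgeom.tendsto_atTop_zero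
    obtain ⟨j, hj⟩ := (hlim.eventually
      (gt_mem_nhds (show (0 : ℝ) < 1 / ((k : ℝ) + 1) by positivity))).exists
    have h1 := (hinv j).trans_lt hj
    rw [one_div_lt_one_div (hN0' j) (by positivity)] at h1
    have h2 : k < N j := by
      have : k + 1 < N j := by exact_mod_cast h1
      omega
    refine (hvs k).tsum_pos (fun j => hv0 j k) j ?_
    simp only [hv, if_pos h2]
    exact one_div_pos.2 (hN0' j)
  · refine (hvs l).tsum_le_tsum (fun j => ?_) (hvs k)
    simp only [hv]
    split_ifs with h1 h2
    · exact le_rfl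
    · omega
    · exact (one_div_pos.2 (hN0' j)).le
    · exact le_rfl
  · refine tendsto_atTop_atTop.2 fun R => ?_
    obtain ⟨J, hJ⟩ := exists_nat_ge R
    refine ⟨(Finset.range J).sup N, fun m hm => hJ.trans ?_⟩
    calc (J : ℝ) = ∑ j ∈ Finset.range J, ∑ k ∈ Finset.range m, v j k := by
          rw [Finset.sum_congr rfl (g := fun _ => (1 : ℝ)), Finset.sum_const, Finset.card_range,
            nsmul_eq_mul, mul_one]
          intro j hj
          have hjm : N j ≤ m := (Finset.le_sup (f := N) hj).trans hm
          simp only [hv]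
          rw [← Finset.sum_filter, Finset.sum_const, nsmul_eq_mul]
          have : (Finset.range m).filter (· < N j) = Finset.range (N j) := by
            ext k
            simp only [Finset.mem_filter, Finset.mem_range]
            omega
          rw [this, Finset.card_range]
          exact mul_one_div_cancel (hN0' j).ne'
      _ = ∑ k ∈ Finset.range m, ∑ j ∈ Finset.range J, v j k := Finset.sum_comm
      _ ≤ ∑ k ∈ Finset.range m, ∑' j, v j k :=
          Finset.sum_le_sum fun k _ => (hvs k).sum_le_tsum _ fun j _ => hv0 j k
  · intro n i hi f hf
    have hterm : ∀ j, ∑ k ∈ Finset.range n, v j k * |f (x (i k))| ≤ 2 * (K * (1 / 2) ^ j) := by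
      intro j
      have h1 : ∑ k ∈ Finset.range n, v j k * |f (x (i k))| =
          1 / (N j : ℝ) * ∑ k ∈ Finset.range n with k < N j, |f (x (i k))| := by
        rw [Finset.mul_sum, Finset.sum_filter]
        refine Finset.sum_congr rfl fun k _ => ?_
        simp only [hv, ite_mul, zero_mul]
      have h2 := sum_abs_dual_le_two_mul (y := fun k => x (i k))
        (s := (Finset.range n).filter (· < N j)) (R := K * ((1 / 2) ^ j * N j))
        (fun A hA => hKN j A i
          (fun k hk => Finset.mem_range.2 (Finset.mem_filter.1 (hA hk)).2)
          (hi.mono fun k hk => (Finset.mem_filter.1 (hA hk)).1)) hf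
      rw [h1, one_div_mul_eq_div, div_le_iff₀ (hN0' j)]
      linarith
    have hsum : ∀ k, Summable fun j => v j k * |f (x (i k))| := fun k => (hvs k).mul_right _
    calc ∑ k ∈ Finset.range n, (∑' j, v j k) * |f (x (i k))|
        = ∑' j, ∑ k ∈ Finset.range n, v j k * |f (x (i k))| := by
          rw [Summable.tsum_finsetSum fun k _ => hsum k]
          exact Finset.sum_congr rfl fun k _ => tsum_mul_right.symm
      _ ≤ ∑' j : ℕ, 2 * (K * (1 / 2) ^ j) :=
          (summable_sum fun k _ => hsum k).tsum_le_tsum hterm (hgeom.mul_left 2)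

end SymmetricSequences

theorem theoremA (Y : Type u) [NormedAddCommGroup Y] [NormedSpace ℝ Y] [CompleteSpace Y]
    (hY : LocallyAMUC Y)
    (h : (∃ x : ℕ → Y, NormalizedSeq x ∧ IsSymmetricBasicSeq x ∧
            ¬ SeqEquivalent x l1UnitVector) ∨
          ∃ p : ℝ, 1 < p ∧ ∃ x : ℕ → Y, NormalizedSeq x ∧ HasUpperEstimates p x) :
    ¬ PropertyB.{v, u} Y := by
  rcases h with ⟨x, hx1, hx, hl1⟩ | ⟨p, hp, x, hx1, hx⟩
  · obtain ⟨K, hK0, hK⟩ := hx.exists_norm_sum_subset_le hx1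
    obtain ⟨w, hw, hanti, hinf, C, hC⟩ := exists_weight_rearrangementBounded hx1 hK0 hK (by
      by_contra! hcon
      obtain ⟨c, hc, hlow⟩ := hcon
      exact hl1 (seqEquivalent_l1_of_le_norm_sum hx1 hK0 hK hc hlow))
    exact not_propertyB_of_rearrangementBounded hY hx1 hw hanti hinf hC
  · obtain ⟨C, hC⟩ := hx.exists_rearrangementBounded hp
    exact not_propertyB_of_rearrangementBounded hY hx1 (fun k => by positivity)
      antitone_one_div_add_one tendsto_sum_range_one_div_add_one_atTop hC
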